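/- For a sequence $f=(f_n)_{n\in\mathbb Z}$ write $(df)_n=f_{n+1}-f_n$ and $(Df)_n=f_{n+1}-2f_n+f_{n-1}$. Let $\alpha_0,\alpha_1,\alpha_2$ be arbitrary functions that assign to every bounded sequence $u$ weights $\alpha_{i,n}(u)\in\mathbb R$ ($n\in\mathbb Z$) with $\alpha_{i,n}(u)\ge 0$ and $\alpha_{0,n}(u)+\alpha_{1,n}(u)+\alpha_{2,n}(u)=1$. The 6-point WENO interpolatory subdivision scheme $S$ is defined on $\ell^\infty(\mathbb Z)$ by $S(f)_{2n}=f_n$ and, with $\alpha_i=\alpha_{i,n}(df)$, $$S(f)_{2n+1}=\tfrac{\alpha_2}{16}f_{n-2}-\tfrac{5\alpha_2+\alpha_1}{16}f_{n-1}+\Big(\tfrac5{16}+\tfrac{5\alpha_2+2\alpha_1}{8}\Big)f_n+\Big(\tfrac5{16}+\tfrac{5\alpha_0+2\alpha_1}{8}\Big)f_{n+1}-\tfrac{5\alpha_0+\alpha_1}{16}f_{n+2}+\tfrac{\alpha_0}{16}f_{n+3}.$$ Then: 1. $S$ is a perturbation of the two-point linear scheme: for all $f\in\ell^\infty(\mathbb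 Z)$ and $n\in\mathbb Z$, with $\alpha_i=\alpha_{i,n}(df)$, $$S(f)_{2n+1}=\frac{f_n+f_{n+1}}2+\frac{\alpha_0}{16}Df_{n+2}-\frac{3\alpha_0+\alpha_1}{16}Df_{n+1}-\frac{\alpha_1+3\alpha_2}{16}Df_n+\frac{\alpha_2}{16}Df_{n-1}.$$ 2. $S$ is uniformly convergent: for every $f\in\ell^\infty(\mathbb Z)$ there is a continuous function $S^\infty f:\mathbb R\to\mathbb R$ with $\lim_{j\to\infty}\sup_{n\in\mathbb Z}|S^j(f)_n-(S^\infty f)(2^{-j}n)|=0$. 3. For every $f\in\ell^\infty(\mathbb Z)$ the limit function belongs to $C^{(-\log_2(3/4))^-}$, that is, $S^\infty f$ is continuous and bounded, and for every $r$ with $0<r<-\log_2(3/4)$ there is $C>0$ such that $|S^\infty f(x)-S^\infty f(y)|\le C|x-y|^r$ for all $x,y\in\mathbb R$. -/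

import Mathlib

open scoped ENNReal

noncomputable section

namespace Subdivision

/-- The interpolatory refinement of a sequence `f`: the old values `f n` are kept at the even
indices `2 n` and the new values `p n` are inserted at the odd indices `2 n + 1`
(`k / 2` is the floor of `k / 2` in `ℤ`). -/
def refine (f p : ℤ → ℝ) (k : ℤ) : ℝ :=
  if Even k then f (k / 2) else p (k / 2)

/-- First differences `(df)_n = f_{n+1} - f_n`. -/
def diff₁ (f : ℤ → ℝ) (n : ℤ) : ℝ := f (n + 1) - f n

/-- Second differences `(Df)_n = f_{n+1} - 2 f_n + f_{n-1}`. -/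
def diff₂ (f : ℤ → ℝ) (n : ℤ) : ℝ := f (n + 1) - 2 * f n + f (n - 1)

/-- The centered two-point linear scheme. -/
def twoPoint (f : ℤ → ℝ) : ℤ → ℝ :=
  refine f fun n => (f n + f (n + 1)) / 2

/-- A weight rule: it assigns to a sequence `u` (in the scheme, `u = df`) the three weights
`α u 0 n, α u 1 n, α u 2 n` that are used at the position `n`. -/
abbrev WeightRule : Type := (ℤ → ℝ) → Fin 3 → ℤ → ℝ

/-- The weights produced from bounded sequences are nonnegative and add up to one. -/
def WeightRule.IsConvex (α : WeightRule) : Prop :=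
  ∀ u : ℤ → ℝ, Memℓp u ∞ → ∀ n : ℤ,
    (∀ i : Fin 3, 0 ≤ α u i n) ∧ α u 0 n + α u 1 n + α u 2 n = 1

/-- The six-point WENO scheme. The inserted value is the convex combination, with the weights
`α₀, α₁, α₂`, of the values at the midpoint of `[n, n + 1]` of the cubic polynomials
interpolating `f` on `{n, …, n + 3}`, `{n - 1, …, n + 2}` and `{n - 2, …, n + 1}`. -/
def weno (α : WeightRule) (f : ℤ → ℝ) : ℤ → ℝ :=
  refine f fun n =>
    let α₀ := α (diff₁ f) 0 n
    let α₁ := α (diff₁ f) 1 n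
    let α₂ := α (diff₁ f) 2 n
    α₂ / 16 * f (n - 2)
      - (5 * α₂ + α₁) / 16 * f (n - 1)
      + (5 / 16 + (5 * α₂ + 2 * α₁) / 8) * f n
      + (5 / 16 + (5 * α₀ + 2 * α₁) / 8) * f (n + 1)
      - (5 * α₀ + α₁) / 16 * f (n + 2)
      + α₀ / 16 * f (n + 3)

/-- The perturbation term, as a function of the two sequences `u = df` and `v = Df`. -/
def wenoPerturbation (α : WeightRule) (u v : ℤ → ℝ) (n : ℤ) : ℝ :=
  let α₀ := α u 0 n
  let α₁ := α u 1 n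
  let α₂ := α u 2 n
  α₀ / 16 * v (n + 2) - (3 * α₀ + α₁) / 16 * v (n + 1)
    - (α₁ + 3 * α₂) / 16 * v n + α₂ / 16 * v (n - 1)

/-- `g` is the limit function `S^∞ f` of the scheme `S` started from `f`: it is continuous and
`sup_n |S^j(f)_n - g(2^{-j} n)|` tends to `0` as `j → ∞`. -/
def IsLimitFunction (S : (ℤ → ℝ) → (ℤ → ℝ)) (f : ℤ → ℝ) (g : ℝ → ℝ) : Prop :=
  Continuous g ∧
    ∀ ε > 0, ∃ J : ℕ, ∀ j ≥ J, ∀ n : ℤ, |S^[j] f n - g ((n : ℝ) / 2 ^ j)| ≤ ε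

/-- Uniform convergence of a subdivision scheme on `ℓ^∞(ℤ)`. -/
def UniformlyConvergent (S : (ℤ → ℝ) → (ℤ → ℝ)) : Prop :=
  ∀ f : ℤ → ℝ, Memℓp f ∞ → ∃ g : ℝ → ℝ, IsLimitFunction S f g

/-- The class `C^{s-}` for `0 < s ≤ 1`: bounded continuous functions that are Hölder continuous
on `ℝ` with every exponent `r ∈ (0, s)`. -/
def IsHolderMinus (s : ℝ) (g : ℝ → ℝ) : Prop :=
  Continuous g ∧ (∃ B : ℝ, ∀ x, |g x| ≤ B) ∧
    ∀ r : ℝ, 0 < r → r < s → ∃ C > 0, ∀ x y : ℝ, |g x - g y| ≤ C * |x - y| ^ r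

end Subdivision

end

namespace Subdivision

open Filter Topology

/-! The weights may depend on the data in any way, so no smoothness of the scheme is available; only
convexity is used. An estimate that is convex in the weights need only be checked at the vertices of
the weight simplex.

The second differences `v = Df` alone need not contract: for alternating `v` of size `M` the even
entry of the refined `Df` can again have size `M`. If the jumps of `v` are also bounded by `4/3 *
M`, then one step gives `3/4 * M` for `Df` and `M` for its jumps (`diff₂_weno_bounds`). Hence `max
‖Df‖ (3/4 ‖dDf‖)` decays like `(3/4)^j`. The perturbation is at most `‖Df‖ / 4`, so `‖df‖` decays at
the same rate (`weno_iterate_bounds`).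

Thus the samples at `⌊x * 2 ^ j⌋` form a geometric Cauchy sequence. Their limit oscillates by
`O((3/4)^j)` at scale `2^{-j}`, which gives the Hölder exponents. Every limit function is the limit
of these samples, so the regularity holds for all of them. -/

lemma refine_even (f p : ℤ → ℝ) (n : ℤ) : refine f p (2 * n) = f n := by
  simp [refine]

lemma refine_odd (f p : ℤ → ℝ) (n : ℤ) : refine f p (2 * n + 1) = p n := by
  have h1 : ¬ Even (2 * n + 1) := by simp
  have h2 : (2 * n + 1) / 2 = n := by lia
  simp only [refine, if_neg h1, h2]

lemma memℓp_top_iff_exists_bound (f : ℤ → ℝ) : Memℓp f ∞ ↔ ∃ K, ∀ n, |f n| ≤ K := by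
  rw [memℓp_infty_iff]
  constructor
  · rintro ⟨K, hK⟩
    exact ⟨K, fun n => hK ⟨n, rfl⟩⟩
  · rintro ⟨K, hK⟩
    exact ⟨K, by rintro _ ⟨n, rfl⟩; exact hK n⟩

lemma memℓp_diff₁ {f : ℤ → ℝ} (hf : Memℓp f ∞) : Memℓp (diff₁ f) ∞ := by
  rw [memℓp_top_iff_exists_bound] at hf ⊢
  obtain ⟨K, hK⟩ := hf
  refine ⟨K + K, fun n => ?_⟩
  exact (abs_sub _ _).trans (add_le_add (hK _) (hK _))

/-! ### Convex weights and the perturbation term -/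

/-- A bound that holds at the three vertices holds for every convex combination. -/
lemma abs_add_convexCombination_le {a₀ a₁ a₂ c q₀ q₁ q₂ B : ℝ} (h₀ : 0 ≤ a₀) (h₁ : 0 ≤ a₁)
    (h₂ : 0 ≤ a₂) (hs : a₀ + a₁ + a₂ = 1) (k₀ : |c + q₀| ≤ B) (k₁ : |c + q₁| ≤ B)
    (k₂ : |c + q₂| ≤ B) : |c + (a₀ * q₀ + a₁ * q₁ + a₂ * q₂)| ≤ B := by
  have e : c + (a₀ * q₀ + a₁ * q₁ + a₂ * q₂) =
      a₀ * (c + q₀) + a₁ * (c + q₁) + a₂ * (c + q₂) := by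
    linear_combination -c * hs
  rw [abs_le] at *
  rw [e]
  have hB : B = a₀ * B + a₁ * B + a₂ * B := by rw [← add_mul, ← add_mul, hs, one_mul]
  constructor
  · linarith [mul_le_mul_of_nonneg_left k₀.1 h₀, mul_le_mul_of_nonneg_left k₁.1 h₁,
      mul_le_mul_of_nonneg_left k₂.1 h₂]
  · linarith [mul_le_mul_of_nonneg_left k₀.2 h₀, mul_le_mul_of_nonneg_left k₁.2 h₁,
      mul_le_mul_of_nonneg_left k₂.2 h₂]

lemma wenoPerturbation_eq (α : WeightRule) (u v : ℤ → ℝ) (n : ℤ) :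
    wenoPerturbation α u v n =
      α u 0 n * ((v (n + 2) - 3 * v (n + 1)) / 16) + α u 1 n * (-(v (n + 1) + v n) / 16) +
        α u 2 n * ((v (n - 1) - 3 * v n) / 16) := by
  simp only [wenoPerturbation]
  ring

lemma weno_even (α : WeightRule) (f : ℤ → ℝ) (n : ℤ) : weno α f (2 * n) = f n :=
  refine_even _ _ n

/-- The weights that `α` assigns to the sequence `u` are nonnegative and add up to one. -/
def ConvexWeights (α : WeightRule) (u : ℤ → ℝ) : Prop :=
  ∀ n, (∀ i, 0 ≤ α u i n) ∧ α u 0 n + α u 1 n + α u 2 n = 1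

lemma weno_odd {α : WeightRule} {f : ℤ → ℝ} (h : ConvexWeights α (diff₁ f)) (n : ℤ) :
    weno α f (2 * n + 1) = (f n + f (n + 1)) / 2 + wenoPerturbation α (diff₁ f) (diff₂ f) n := by
  have h2 : α (diff₁ f) 2 n = 1 - α (diff₁ f) 0 n - α (diff₁ f) 1 n := by
    linarith [(h n).2]
  have e1 : n + 2 + 1 = n + 3 := by ring
  have e2 : n + 2 - 1 = n + 1 := by ring
  have e3 : n + 1 + 1 = n + 2 := by ring
  have e4 : n + 1 - 1 = n := by ring
  have e5 : n - 1 + 1 = n := by ring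
  have e6 : n - 1 - 1 = n - 2 := by ring
  rw [weno, refine_odd]
  simp only [wenoPerturbation, diff₂, e1, e2, e3, e4, e5, e6, h2]
  ring

/-- Bound of a step functional by the vertices of the weight simplex at one position. -/
lemma abs_add_mul_wenoPerturbation_le {α : WeightRule} {u : ℤ → ℝ} (h : ConvexWeights α u)
    (v : ℤ → ℝ) (n : ℤ) (s : ℝ) {c B : ℝ}
    (k₀ : |c + s * ((v (n + 2) - 3 * v (n + 1)) / 16)| ≤ B)
    (k₁ : |c + s * (-(v (n + 1) + v n) / 16)| ≤ B)
    (k₂ : |c + s * ((v (n - 1) - 3 * v n) / 16)| ≤ B) :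
    |c + s * wenoPerturbation α u v n| ≤ B := by
  have := abs_add_convexCombination_le ((h n).1 0) ((h n).1 1) ((h n).1 2) (h n).2 k₀ k₁ k₂
  rw [wenoPerturbation_eq]
  convert this using 2
  ring

/-- Bound of a step functional by the vertices of the weight simplices at two positions. -/
lemma abs_add_mul_wenoPerturbation₂_le {α : WeightRule} {u : ℤ → ℝ} (h : ConvexWeights α u)
    (v : ℤ → ℝ) (n m : ℤ) (s s' : ℝ) {c B : ℝ}
    (k : ∀ q ∈ ({(v (n + 2) - 3 * v (n + 1)) / 16, -(v (n + 1) + v n) / 16,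
        (v (n - 1) - 3 * v n) / 16} : Set ℝ),
      ∀ q' ∈ ({(v (m + 2) - 3 * v (m + 1)) / 16, -(v (m + 1) + v m) / 16,
        (v (m - 1) - 3 * v m) / 16} : Set ℝ), |c + s * q + s' * q'| ≤ B) :
    |c + s * wenoPerturbation α u v n + s' * wenoPerturbation α u v m| ≤ B := by
  -- The weights at `m` and `n` are moved to vertices one position at a time, the other term being
  -- absorbed into `c`.
  apply abs_add_mul_wenoPerturbation_le h v m s' <;>
  · rw [add_right_comm]
    apply abs_add_mul_wenoPerturbation_le h v n s <;>
    · rw [add_right_comm]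
      exact k _ (by simp) _ (by simp)

/-- At each vertex the absolute values of the coefficients add up to `4/16` or `2/16`. -/
lemma abs_wenoPerturbation_le {α : WeightRule} {u v : ℤ → ℝ} (h : ConvexWeights α u) {M : ℝ}
    (hv : ∀ n, |v n| ≤ M) (n : ℤ) : |wenoPerturbation α u v n| ≤ M / 4 := by
  have a1 := abs_le.1 (hv (n - 1))
  have a2 := abs_le.1 (hv n)
  have a3 := abs_le.1 (hv (n + 1))
  have a4 := abs_le.1 (hv (n + 2))
  have := abs_add_mul_wenoPerturbation_le h v n 1 (c := 0) (B := M / 4)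
    (abs_le.2 ⟨by linarith, by linarith⟩) (abs_le.2 ⟨by linarith, by linarith⟩)
    (abs_le.2 ⟨by linarith, by linarith⟩)
  simpa using this

/-! ### Contraction of the differences -/

lemma diff₂_weno_odd {α : WeightRule} {f : ℤ → ℝ} (h : ConvexWeights α (diff₁ f)) (n : ℤ) :
    diff₂ (weno α f) (2 * n + 1) = -2 * wenoPerturbation α (diff₁ f) (diff₂ f) n := by
  rw [diff₂, show 2 * n + 1 + 1 = 2 * (n + 1) by ring, show 2 * n + 1 - 1 = 2 * n by ring,
    weno_even, weno_even, weno_odd h]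
  ring

/-- The factors `1` give the right-hand side the shape required by
`abs_add_mul_wenoPerturbation₂_le`. -/
lemma diff₂_weno_even {α : WeightRule} {f : ℤ → ℝ} (h : ConvexWeights α (diff₁ f)) (n : ℤ) :
    diff₂ (weno α f) (2 * n) = diff₂ f n / 2 + 1 * wenoPerturbation α (diff₁ f) (diff₂ f) n +
      1 * wenoPerturbation α (diff₁ f) (diff₂ f) (n - 1) := by
  rw [diff₂, show 2 * n - 1 = 2 * (n - 1) + 1 by ring, weno_even, weno_odd h, weno_odd h, diff₂,
    show n - 1 + 1 = n by ring]
  ring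

lemma diff₁_diff₂_weno_even {α : WeightRule} {f : ℤ → ℝ} (h : ConvexWeights α (diff₁ f))
    (n : ℤ) : diff₁ (diff₂ (weno α f)) (2 * n) =
      -diff₂ f n / 2 + -3 * wenoPerturbation α (diff₁ f) (diff₂ f) n +
        -1 * wenoPerturbation α (diff₁ f) (diff₂ f) (n - 1) := by
  rw [diff₁, diff₂_weno_odd h, diff₂_weno_even h]
  ring

lemma diff₁_diff₂_weno_odd {α : WeightRule} {f : ℤ → ℝ} (h : ConvexWeights α (diff₁ f))
    (n : ℤ) : diff₁ (diff₂ (weno α f)) (2 * n + 1) =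
      diff₂ f (n + 1) / 2 + 3 * wenoPerturbation α (diff₁ f) (diff₂ f) n +
        1 * wenoPerturbation α (diff₁ f) (diff₂ f) (n + 1) := by
  rw [diff₁, diff₂_weno_odd h, show 2 * n + 1 + 1 = 2 * (n + 1) by ring, diff₂_weno_even h,
    show n + 1 - 1 = n by ring]
  ring

/-- One step contracts the norm `max ‖Df‖ (3/4 ‖dDf‖)` by the factor `3/4`. -/
lemma diff₂_weno_bounds {α : WeightRule} {f : ℤ → ℝ} (h : ConvexWeights α (diff₁ f)) {M : ℝ}
    (hv : ∀ n, |diff₂ f n| ≤ M) (ht : ∀ n, |diff₁ (diff₂ f) n| ≤ 4 / 3 * M) :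
    (∀ n, |diff₂ (weno α f) n| ≤ 3 / 4 * M) ∧ ∀ n, |diff₁ (diff₂ (weno α f)) n| ≤ M := by
  have hv' : ∀ n, -M ≤ diff₂ f n ∧ diff₂ f n ≤ M := fun n => abs_le.1 (hv n)
  have ht' : ∀ n, -(4 / 3 * M) ≤ diff₂ f (n + 1) - diff₂ f n ∧
      diff₂ f (n + 1) - diff₂ f n ≤ 4 / 3 * M := fun n => abs_le.1 (ht n)
  have hM : 0 ≤ M := (abs_nonneg _).trans (hv 0)
  -- With the odd index written as `2 * n - 1`, all three estimates involve only `v (n - 2), …, v (n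
  -- + 2)`.
  have key : ∀ n, |diff₂ (weno α f) (2 * n)| ≤ 3 / 4 * M ∧
      |diff₁ (diff₂ (weno α f)) (2 * n)| ≤ M ∧
      |diff₁ (diff₂ (weno α f)) (2 * n - 1)| ≤ M := by
    intro n
    have e1 : n - 1 + 1 = n := by ring
    have e2 : n - 1 + 2 = n + 1 := by ring
    have e3 : n - 1 - 1 = n - 2 := by ring
    have e4 : n + 1 + 1 = n + 2 := by ring
    have e5 : n - 2 + 1 = n - 1 := by ring
    obtain ⟨a1, a1'⟩ := hv' (n - 2)
    obtain ⟨a2, a2'⟩ := hv' (n - 1)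
    obtain ⟨a3, a3'⟩ := hv' n
    obtain ⟨a4, a4'⟩ := hv' (n + 1)
    obtain ⟨a5, a5'⟩ := hv' (n + 2)
    have t1 := ht' (n - 2)
    have t2 := ht' (n - 1)
    have t3 := ht' n
    have t4 := ht' (n + 1)
    rw [e5] at t1
    rw [e1] at t2
    rw [e4] at t4
    obtain ⟨t1, t1'⟩ := t1
    obtain ⟨t2, t2'⟩ := t2
    obtain ⟨t3, t3'⟩ := t3
    obtain ⟨t4, t4'⟩ := t4
    refine ⟨?_, ?_, ?_⟩
    -- Extremal case: `v n = M` forces `v (n ± 1) ≥ -M / 3`, so each perturbation is at most `M / 8`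
    -- and the sum at most `M / 2 + M / 8 + M / 8`.
    · rw [diff₂_weno_even h]
      apply abs_add_mul_wenoPerturbation₂_le h
      simp only [e1, e2, e3, Set.mem_insert_iff, Set.mem_singleton_iff]
      rintro q (rfl | rfl | rfl) q' (rfl | rfl | rfl) <;>
      exact abs_le.2 ⟨by linarith, by linarith⟩
    · rw [diff₁_diff₂_weno_even h]
      apply abs_add_mul_wenoPerturbation₂_le h
      simp only [e1, e2, e3, Set.mem_insert_iff, Set.mem_singleton_iff]
      rintro q (rfl | rfl | rfl) q' (rfl | rfl | rfl) <;>
      exact abs_le.2 ⟨by linarith, by linarith⟩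
    · rw [show 2 * n - 1 = 2 * (n - 1) + 1 by ring, diff₁_diff₂_weno_odd h]
      apply abs_add_mul_wenoPerturbation₂_le h
      simp only [e1, e2, e3, Set.mem_insert_iff, Set.mem_singleton_iff]
      rintro q (rfl | rfl | rfl) q' (rfl | rfl | rfl) <;>
      exact abs_le.2 ⟨by linarith, by linarith⟩
  constructor <;> intro k <;> obtain ⟨n, rfl | rfl⟩ := Int.even_or_odd' k
  · exact (key n).1
  · rw [diff₂_weno_odd h, abs_mul]
    have := abs_wenoPerturbation_le h hv n
    norm_num
    linarith
  · exact (key n).2.1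
  · rw [show 2 * n + 1 = 2 * (n + 1) - 1 by ring]
    exact (key (n + 1)).2.2

/-! ### Growth of the iterates and decay of their differences -/

lemma abs_weno_le {α : WeightRule} {f : ℤ → ℝ} (h : ConvexWeights α (diff₁ f)) {K M : ℝ}
    (hf : ∀ n, |f n| ≤ K) (hv : ∀ n, |diff₂ f n| ≤ M) (n : ℤ) : |weno α f n| ≤ K + M / 4 := by
  have hM : 0 ≤ M := (abs_nonneg _).trans (hv 0)
  obtain ⟨m, rfl | rfl⟩ := Int.even_or_odd' n
  · rw [weno_even]
    linarith [hf m]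
  · rw [weno_odd h]
    have a1 := abs_le.1 (hf m)
    have a2 := abs_le.1 (hf (m + 1))
    have a3 := abs_le.1 (abs_wenoPerturbation_le h hv m)
    exact abs_le.2 ⟨by linarith, by linarith⟩

lemma abs_weno_sub_le {α : WeightRule} {f : ℤ → ℝ} (h : ConvexWeights α (diff₁ f)) {U M : ℝ}
    (hu : ∀ n, |diff₁ f n| ≤ U) (hv : ∀ n, |diff₂ f n| ≤ M) (n : ℤ) :
    |weno α f (2 * n + 1) - f n| ≤ U / 2 + M / 4 ∧
      |f (n + 1) - weno α f (2 * n + 1)| ≤ U / 2 + M / 4 := by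
  rw [weno_odd h]
  have a1 := abs_le.1 (hu n)
  have a3 := abs_le.1 (abs_wenoPerturbation_le h hv n)
  rw [diff₁] at a1
  exact ⟨abs_le.2 ⟨by linarith, by linarith⟩, abs_le.2 ⟨by linarith, by linarith⟩⟩

lemma abs_diff₁_weno_le {α : WeightRule} {f : ℤ → ℝ} (h : ConvexWeights α (diff₁ f)) {U M : ℝ}
    (hu : ∀ n, |diff₁ f n| ≤ U) (hv : ∀ n, |diff₂ f n| ≤ M) (n : ℤ) :
    |diff₁ (weno α f) n| ≤ U / 2 + M / 4 := by
  obtain ⟨m, rfl | rfl⟩ := Int.even_or_odd' n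
  · rw [diff₁, weno_even]
    exact (abs_weno_sub_le h hu hv m).1
  · rw [diff₁, show 2 * m + 1 + 1 = 2 * (m + 1) by ring, weno_even]
    exact (abs_weno_sub_le h hu hv m).2

/-- Geometric decay of the differences along the iteration. -/
lemma weno_iterate_bounds {α : WeightRule} (hα : α.IsConvex) {f : ℤ → ℝ} {K : ℝ}
    (hf : ∀ n, |f n| ≤ K) (j : ℕ) :
    ConvexWeights α (diff₁ ((weno α)^[j] f)) ∧
    (∀ n, |(weno α)^[j] f n| ≤ 11 * K - 10 * K * (3 / 4) ^ j) ∧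
    (∀ n, |diff₁ ((weno α)^[j] f) n| ≤ 8 * K * (3 / 4) ^ j) ∧
    (∀ n, |diff₂ ((weno α)^[j] f) n| ≤ 8 * K * (3 / 4) ^ j) ∧
    ∀ n, |diff₁ (diff₂ ((weno α)^[j] f)) n| ≤ 4 / 3 * (8 * K * (3 / 4) ^ j) := by
  have conv : ∀ g : ℤ → ℝ, (∃ B, ∀ n, |g n| ≤ B) → ConvexWeights α (diff₁ g) := fun g hg =>
    hα _ (memℓp_diff₁ ((memℓp_top_iff_exists_bound g).2 hg))
  have hK : 0 ≤ K := (abs_nonneg _).trans (hf 0)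
  have hf' : ∀ n, -K ≤ f n ∧ f n ≤ K := fun n => abs_le.1 (hf n)
  induction j with
  | zero =>
    -- The constant `8 * K` covers differences up to order three, whose coefficients have absolute
    -- sums 2, 4 and 8.
    refine ⟨conv f ⟨K, hf⟩, fun n => ?_, fun n => ?_, fun n => ?_, fun n => ?_⟩
    · simp only [Function.iterate_zero, id, pow_zero]
      linarith [hf n]
    all_goals
      simp only [Function.iterate_zero, id, pow_zero, diff₁, diff₂]
      obtain ⟨_, _⟩ := hf' n
      obtain ⟨_, _⟩ := hf' (n + 1)
      obtain ⟨_, _⟩ := hf' (n - 1)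
      obtain ⟨_, _⟩ := hf' (n + 1 + 1)
      try rw [show n + 1 - 1 = n by ring]
      exact abs_le.2 ⟨by linarith, by linarith⟩
  | succ j ih =>
    obtain ⟨hc, h0, h1, h2, h3⟩ := ih
    simp only [Function.iterate_succ_apply']
    have b := diff₂_weno_bounds hc h2 h3
    have b0 := abs_weno_le hc h0 h2
    have hp : 0 ≤ K * (3 / 4) ^ j := by positivity
    -- Boundedness of the new iterate is what makes its weights convex. The sup bound gains `2 * K *
    -- (3/4)^j`, less than the allowed `5/2 * K * (3/4)^j`; for `df`, `U / 2 + M / 4` with `U = M`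
    -- is exactly `3/4 * M`.
    refine ⟨conv _ ⟨_, b0⟩, fun n => (b0 n).trans ?_,
      fun n => (abs_diff₁_weno_le hc h1 h2 n).trans ?_, fun n => (b.1 n).trans ?_,
      fun n => (b.2 n).trans ?_⟩ <;> rw [pow_succ] <;> linarith

/-! ### Limits of dyadic samples -/

/-- The dyadic samples of the `j`-th iterate. -/
noncomputable def dyadicSample (S : (ℤ → ℝ) → (ℤ → ℝ)) (f : ℤ → ℝ) (x : ℝ) (j : ℕ) : ℝ :=
  S^[j] f ⌊x * 2 ^ j⌋

lemma floor_mul_two (y : ℝ) : ⌊y * 2⌋ = 2 * ⌊y⌋ ∨ ⌊y * 2⌋ = 2 * ⌊y⌋ + 1 := by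
  have h1 : 2 * ⌊y⌋ ≤ ⌊y * 2⌋ := by
    rw [Int.le_floor]
    push_cast
    linarith [Int.floor_le y]
  have h2 : ⌊y * 2⌋ < 2 * ⌊y⌋ + 2 := by
    rw [Int.floor_lt]
    push_cast
    linarith [Int.lt_floor_add_one y]
  lia

/-- Refining the grid either keeps the sample or moves it to the adjacent inserted value; `6 = 8 / 2
+ 8 / 4`. -/
lemma dist_dyadicSample_succ_le {α : WeightRule} (hα : α.IsConvex) {f : ℤ → ℝ} {K : ℝ}
    (hf : ∀ n, |f n| ≤ K) (x : ℝ) (j : ℕ) :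
    dist (dyadicSample (weno α) f x j) (dyadicSample (weno α) f x (j + 1)) ≤
      6 * K * (3 / 4) ^ j := by
  obtain ⟨hc, -, h1, h2, -⟩ := weno_iterate_bounds hα hf j
  have hK : 0 ≤ K := (abs_nonneg _).trans (hf 0)
  rw [dist_comm, Real.dist_eq, dyadicSample, dyadicSample, pow_succ, ← mul_assoc,
    Function.iterate_succ_apply']
  rcases floor_mul_two (x * 2 ^ j) with e | e <;> rw [e]
  · rw [weno_even, sub_self, abs_zero]
    positivity
  · refine (abs_weno_sub_le hc h1 h2 _).1.trans ?_
    linarith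

lemma exists_tendsto_dyadicSample {α : WeightRule} (hα : α.IsConvex) {f : ℤ → ℝ} {K : ℝ}
    (hf : ∀ n, |f n| ≤ K) (x : ℝ) :
    ∃ y, Tendsto (dyadicSample (weno α) f x) atTop (𝓝 y) :=
  cauchySeq_tendsto_of_complete
    (cauchySeq_of_le_geometric _ _ (by norm_num) (dist_dyadicSample_succ_le hα hf x))

lemma abs_dyadicSample_sub_le {α : WeightRule} (hα : α.IsConvex) {f : ℤ → ℝ} {K : ℝ}
    (hf : ∀ n, |f n| ≤ K) {x y : ℝ} (h : Tendsto (dyadicSample (weno α) f x) atTop (𝓝 y))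
    (j : ℕ) : |dyadicSample (weno α) f x j - y| ≤ 24 * K * (3 / 4) ^ j := by
  have := dist_le_of_le_geometric_of_tendsto _ _ (by norm_num)
    (dist_dyadicSample_succ_le hα hf x) h j
  rw [Real.dist_eq] at this
  refine this.trans_eq ?_
  ring

/-- Points at distance at most `2^{-j}` lie in the same or in adjacent cells, so one first
difference suffices. -/
lemma abs_dyadicSample_sub_dyadicSample_le {α : WeightRule} (hα : α.IsConvex) {f : ℤ → ℝ}
    {K : ℝ} (hf : ∀ n, |f n| ≤ K) {x y : ℝ} {j : ℕ} (hxy : x ≤ y) (h : (y - x) * 2 ^ j ≤ 1) :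
    |dyadicSample (weno α) f x j - dyadicSample (weno α) f y j| ≤ 8 * K * (3 / 4) ^ j := by
  have hK : 0 ≤ K := (abs_nonneg _).trans (hf 0)
  have h1 : ⌊x * 2 ^ j⌋ ≤ ⌊y * 2 ^ j⌋ := Int.floor_le_floor (by gcongr)
  have h2 : ⌊y * 2 ^ j⌋ < ⌊x * 2 ^ j⌋ + 2 := by
    rw [Int.floor_lt]
    push_cast
    linarith [Int.lt_floor_add_one (x * 2 ^ j)]
  have h3 : ⌊y * 2 ^ j⌋ = ⌊x * 2 ^ j⌋ ∨ ⌊y * 2 ^ j⌋ = ⌊x * 2 ^ j⌋ + 1 := by lia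
  rw [dyadicSample, dyadicSample]
  rcases h3 with e | e <;> rw [e]
  · rw [sub_self, abs_zero]
    positivity
  · rw [abs_sub_comm]
    exact (weno_iterate_bounds hα hf j).2.2.1 _

/-- If `g x` is the limit of the dyadic samples at every `x`, then `g` oscillates by at most a
multiple of `(3/4)^j` on intervals of length `2^{-j}`. -/
lemma abs_sub_le_of_tendsto_dyadicSample {α : WeightRule} (hα : α.IsConvex) {f : ℤ → ℝ}
    {K : ℝ} (hf : ∀ n, |f n| ≤ K) {g : ℝ → ℝ}
    (hg : ∀ x, Tendsto (dyadicSample (weno α) f x) atTop (𝓝 (g x))) {x y : ℝ} {j : ℕ}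
    (h : |x - y| * 2 ^ j ≤ 1) : |g x - g y| ≤ 56 * K * (3 / 4) ^ j := by
  wlog hxy : x ≤ y generalizing x y
  · rw [abs_sub_comm]
    exact this (by rwa [abs_sub_comm]) (le_of_not_ge hxy)
  rw [abs_sub_comm, abs_of_nonneg (sub_nonneg.2 hxy)] at h
  -- Comparison through level `j`: `56 = 24 + 8 + 24`.
  have a1 := abs_le.1 (abs_dyadicSample_sub_le hα hf (hg x) j)
  have a2 := abs_le.1 (abs_dyadicSample_sub_le hα hf (hg y) j)
  have a3 := abs_le.1 (abs_dyadicSample_sub_dyadicSample_le hα hf hxy h)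
  exact abs_le.2 ⟨by linarith, by linarith⟩

lemma abs_le_of_tendsto_dyadicSample {α : WeightRule} (hα : α.IsConvex) {f : ℤ → ℝ}
    {K : ℝ} (hf : ∀ n, |f n| ≤ K) {g : ℝ → ℝ}
    (hg : ∀ x, Tendsto (dyadicSample (weno α) f x) atTop (𝓝 (g x))) (x : ℝ) :
    |g x| ≤ 25 * K := by
  have a1 := abs_le.1 (abs_dyadicSample_sub_le hα hf (hg x) 0)
  have a2 := abs_le.1 (hf ⌊x * 2 ^ 0⌋)
  simp only [dyadicSample, Function.iterate_zero, id, pow_zero] at a1 a2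
  exact abs_le.2 ⟨by linarith, by linarith⟩

/-! ### Hölder regularity -/

/-- A bounded function whose oscillation on the scale `2^{-j}` is `O((3/4)^j)` is Hölder
continuous with every exponent `r ∈ (0, -log₂ (3/4))`. -/
lemma exists_holder_bound {g : ℝ → ℝ} {B A : ℝ} (hB : ∀ x, |g x| ≤ B)
    (hA : ∀ x y (j : ℕ), |x - y| * 2 ^ j ≤ 1 → |g x - g y| ≤ A * (3 / 4) ^ j) {r : ℝ}
    (hr : 0 < r) (hrs : r < -Real.logb 2 (3 / 4)) :
    ∃ C > 0, ∀ x y, |g x - g y| ≤ C * |x - y| ^ r := by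
  have hB0 : 0 ≤ B := (abs_nonneg _).trans (hB 0)
  have hA0 : 0 ≤ A := by
    have := (abs_nonneg _).trans (hA 0 0 0 (by simp))
    simpa using this
  have hq : (3 / 4 : ℝ) ≤ (1 / 2 : ℝ) ^ r := by
    have : (3 / 4 : ℝ) = 2 ^ Real.logb 2 (3 / 4) := by
      rw [Real.rpow_logb] <;> norm_num
    rw [this, one_div, Real.inv_rpow (by norm_num), ← Real.rpow_neg (by norm_num)]
    exact Real.rpow_le_rpow_of_exponent_le (by norm_num) (by linarith)
  -- `A * 2 ^ r` serves distances at most 1, `2 * B` the larger ones, and `1` makes the constant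
  -- positive.
  refine ⟨2 * B + A * 2 ^ r + 1, by positivity, fun x y => ?_⟩
  rcases eq_or_ne x y with rfl | hxy
  · simp [hr.ne']
  have hd : 0 < |x - y| := abs_pos.2 (sub_ne_zero.2 hxy)
  have hdr : 0 < |x - y| ^ r := Real.rpow_pos_of_pos hd r
  rcases le_or_gt |x - y| 1 with h1 | h1
  -- The level `j` satisfies `(1/2)^(j+1) < |x - y| ≤ (1/2)^j`; the lower bound costs the factor `2
  -- ^ r`.
  · obtain ⟨j, hj1, hj2⟩ := exists_nat_pow_near_of_lt_one hd h1
      (by norm_num : (0 : ℝ) < 1 / 2) (by norm_num)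
    have hlev : |x - y| * 2 ^ j ≤ 1 := by
      calc |x - y| * 2 ^ j ≤ (1 / 2) ^ j * 2 ^ j := by gcongr
        _ = 1 := by rw [← mul_pow]; norm_num
    calc |g x - g y| ≤ A * (3 / 4) ^ j := hA x y j hlev
      _ ≤ A * ((1 / 2 : ℝ) ^ r) ^ j := by gcongr
      _ = A * ((1 / 2 : ℝ) ^ j) ^ r := by
        rw [← Real.rpow_natCast, ← Real.rpow_natCast, ← Real.rpow_mul (by norm_num),
          ← Real.rpow_mul (by norm_num), mul_comm r]
      _ ≤ A * (2 * |x - y|) ^ r := by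
        gcongr
        rw [pow_succ] at hj1
        linarith
      _ = A * 2 ^ r * |x - y| ^ r := by
        rw [Real.mul_rpow (by norm_num) hd.le, mul_assoc]
      _ ≤ (2 * B + A * 2 ^ r + 1) * |x - y| ^ r := by
        gcongr
        linarith
  · have h2 : 1 ≤ |x - y| ^ r := Real.one_le_rpow h1.le hr.le
    have h3 : 0 ≤ A * (2 : ℝ) ^ r := by positivity
    calc |g x - g y| ≤ |g x| + |g y| := abs_sub _ _
      _ ≤ (2 * B + A * 2 ^ r + 1) * 1 := by linarith [hB x, hB y]
      _ ≤ (2 * B + A * 2 ^ r + 1) * |x - y| ^ r := by gcongr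

lemma continuous_of_holder_bound {g : ℝ → ℝ} {C r : ℝ} (hr : 0 < r)
    (h : ∀ x y, |g x - g y| ≤ C * |x - y| ^ r) : Continuous g := by
  rw [continuous_iff_continuousAt]
  intro x
  rw [ContinuousAt, tendsto_iff_dist_tendsto_zero]
  have hlim : Tendsto (fun y => C * |y - x| ^ r) (𝓝 x) (𝓝 0) := by
    have hc : Continuous fun y => C * |y - x| ^ r :=
      continuous_const.mul ((continuous_id.sub continuous_const).abs.rpow_const
        fun _ => Or.inr hr.le)
    have := hc.tendsto x
    simpa [hr.ne'] using this
  exact squeeze_zero (fun _ => dist_nonneg) (fun y => h y x) hlim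

lemma isHolderMinus_of_tendsto_dyadicSample {α : WeightRule} (hα : α.IsConvex) {f : ℤ → ℝ}
    {K : ℝ} (hf : ∀ n, |f n| ≤ K) {g : ℝ → ℝ}
    (hg : ∀ x, Tendsto (dyadicSample (weno α) f x) atTop (𝓝 (g x))) :
    IsHolderMinus (-Real.logb 2 (3 / 4)) g := by
  have hB := abs_le_of_tendsto_dyadicSample hα hf hg
  have hH : ∀ r : ℝ, 0 < r → r < -Real.logb 2 (3 / 4) →
      ∃ C > 0, ∀ x y : ℝ, |g x - g y| ≤ C * |x - y| ^ r := fun r hr hrs =>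
    exists_holder_bound hB (fun x y j h => abs_sub_le_of_tendsto_dyadicSample hα hf hg h) hr hrs
  have hs : 0 < -Real.logb 2 (3 / 4) :=
    neg_pos.2 (Real.logb_neg (by norm_num) (by norm_num) (by norm_num))
  obtain ⟨C, -, hCb⟩ := hH _ (half_pos hs) (half_lt_self hs)
  exact ⟨continuous_of_holder_bound (half_pos hs) hCb, ⟨_, hB⟩, hH⟩

/-! ### Limit functions and uniform convergence -/

/-- A limit function is the pointwise limit of the dyadic samples. -/
lemma IsLimitFunction.tendsto_dyadicSample {S : (ℤ → ℝ) → (ℤ → ℝ)} {f : ℤ → ℝ} {g : ℝ → ℝ}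
    (h : IsLimitFunction S f g) (x : ℝ) : Tendsto (dyadicSample S f x) atTop (𝓝 (g x)) := by
  have hx : Tendsto (fun j : ℕ => (⌊x * 2 ^ j⌋ : ℝ) / 2 ^ j) atTop (𝓝 x) := by
    have hlim : Tendsto (fun j : ℕ => (1 / 2 : ℝ) ^ j) atTop (𝓝 0) :=
      tendsto_pow_atTop_nhds_zero_of_lt_one (by norm_num) (by norm_num)
    refine tendsto_iff_dist_tendsto_zero.2 (squeeze_zero (fun _ => dist_nonneg) (fun j => ?_) hlim)
    have hp : (0 : ℝ) < 2 ^ j := by positivity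
    have e : (⌊x * 2 ^ j⌋ : ℝ) / 2 ^ j - x = -(Int.fract (x * 2 ^ j) / 2 ^ j) := by
      rw [Int.fract]
      field_simp
      ring
    rw [Real.dist_eq, e, abs_neg, abs_of_nonneg (div_nonneg (Int.fract_nonneg _) hp.le),
      one_div_pow]
    gcongr
    exact (Int.fract_lt_one _).le
  have h1 : Tendsto (fun j : ℕ => g ((⌊x * 2 ^ j⌋ : ℝ) / 2 ^ j)) atTop (𝓝 (g x)) :=
    (h.1.tendsto x).comp hx
  have h2 : Tendsto (fun j : ℕ => dyadicSample S f x j - g ((⌊x * 2 ^ j⌋ : ℝ) / 2 ^ j)) atTop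
      (𝓝 0) := by
    rw [Metric.tendsto_atTop]
    intro ε hε
    obtain ⟨J, hJ⟩ := h.2 (ε / 2) (half_pos hε)
    refine ⟨J, fun j hj => ?_⟩
    rw [Real.dist_eq, sub_zero]
    exact (hJ j hj _).trans_lt (half_lt_self hε)
  simpa using h2.add h1

lemma uniformlyConvergent_weno {α : WeightRule} (hα : α.IsConvex) :
    UniformlyConvergent (weno α) := by
  intro f hf
  obtain ⟨K, hK⟩ := (memℓp_top_iff_exists_bound f).1 hf
  choose g hg using exists_tendsto_dyadicSample hα hK
  refine ⟨g, (isHolderMinus_of_tendsto_dyadicSample hα hK hg).1, fun ε hε => ?_⟩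
  have hlim : Tendsto (fun j : ℕ => 24 * K * (3 / 4 : ℝ) ^ j) atTop (𝓝 0) := by
    simpa using (tendsto_pow_atTop_nhds_zero_of_lt_one (by norm_num : (0 : ℝ) ≤ 3 / 4)
      (by norm_num)).const_mul (24 * K)
  obtain ⟨J, hJ⟩ := eventually_atTop.1 (hlim.eventually_le_const hε)
  refine ⟨J, fun j hj n => le_trans ?_ (hJ j hj)⟩
  -- At the grid point `n / 2 ^ j` the floor is exactly `n`, so the level-`j` sample is the iterate
  -- at `n` and the bound is uniform in `n`.
  have := abs_dyadicSample_sub_le hα hK (hg ((n : ℝ) / 2 ^ j)) j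
  rwa [dyadicSample, div_mul_cancel₀ _ (by positivity), Int.floor_intCast] at this

end Subdivision

theorem mainTheorem3 (α : Subdivision.WeightRule) (hα : α.IsConvex) :
    (∀ f : ℤ → ℝ, Memℓp f ∞ → ∀ n : ℤ,
      Subdivision.weno α f (2 * n + 1) =
          Subdivision.twoPoint f (2 * n + 1) +
            Subdivision.wenoPerturbation α (Subdivision.diff₁ f) (Subdivision.diff₂ f) n ∧
        Subdivision.weno α f (2 * n) = f n) ∧
    Subdivision.UniformlyConvergent (Subdivision.weno α) ∧
    ∀ f : ℤ → ℝ, Memℓp f ∞ → ∀ g : ℝ → ℝ,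
      Subdivision.IsLimitFunction (Subdivision.weno α) f g →
        Subdivision.IsHolderMinus (-Real.logb 2 (3 / 4)) g := by
  refine ⟨fun f hf n => ⟨?_, Subdivision.weno_even α f n⟩,
    Subdivision.uniformlyConvergent_weno hα, fun f hf g hg => ?_⟩
  · rw [Subdivision.weno_odd (hα _ (Subdivision.memℓp_diff₁ hf)), Subdivision.twoPoint,
      Subdivision.refine_odd]
  · obtain ⟨K, hK⟩ := (Subdivision.memℓp_top_iff_exists_bound f).1 hf
    exact Subdivision.isHolderMinus_of_tendsto_dyadicSample hα hK hg.tendsto_dyadicSample
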